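/- Let $G=\{s_i\}_{i\in\mathbb N}$ be an enumerated countable discrete group with $s_0=e$ (repetitions are allowed, so $G$ may be finite), acting on a non-empty countable set $\mathfrak X$, and let $\omega$ be a free ultrafilter on $\mathbb N$. Let $$\ell^\infty(\mathfrak X)_\omega=\Big(\prod_{n\in\mathbb N}\ell^\infty(\mathfrak X)\Big)\Big/\{(f_n): \lim_{n\to\omega}\|f_n\|_\infty=0\}$$ be the $C^*$-ultrapower (the product consists of the uniformly bounded sequences), with elements written $(f_n)^\bullet$ and with the action of $G$ induced by $(gf)(x)=f(g^{-1}x)$, and let $\sigma(\ell^\infty(\mathfrak X)_\omega)$ be its spectrum with the dual action of $G$. For a uniformly bounded sequence $\xi=(\xi_n)$ in $\ell^2(\mathfrak X)$ let $\mu_\xi$ be the Radon measure on $\sigma(\ell^\infty(\mathfrak X)_\omega)$ corresponding to the functional $(f_n)^\bullet\mapsto\lim_{n\to\omega}\langle f_n\xi_n,\xi_n\rangle$. A uniform approximant of a non-standard point, associated to a sequence $(\alpha_i)_{i\in\mathbb N}$ with $\alpha_i\ge 0$ and $\sum_{i,j}\alpha_i\alpha_j<\infty$, is a probability measure of the form $\mu_\xi$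 with $\xi_n=\sum_i\alpha_i\delta_{s_ix_n}$ for some sequence $(x_n)$ in $\mathfrak X$. Let $\mu=\sum_{m=1}^{l}\lambda_m\mu_m$ be a finite convex combination of uniform approximants $\mu_m$ of non-standard points associated to sequences $(\alpha^{(m)}_i)_i$ with $\alpha_i^{(m)}>0$ for all $i$ and $m$, and suppose that $\mu$ is a $G$-quasi-invariant Radon probability measure on $\sigma(\ell^\infty(\mathfrak X)_\omega)$. Then the pair $(L^\infty(\mu\otimes\mu),L^\infty(\mu))$ is amenable: with respect to the diagonal action of $G$ on $L^\infty(\mu\otimes\mu)$ and the inclusion $L^\infty(\mu)\to L^\infty(\mu\otimes\mu)$, $f\mapsto f\otimes 1$, there is a $G$-equivariant linear projection $E:L^\infty(\mu\otimes\mu)\to L^\infty(\mu)$ of norm one, so that $E(f\otimes 1)=f$ for every $f\in L^\infty(\mu)$. -/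

import Mathlib

open MeasureTheory Filter Topology
open scoped ENNReal lp

noncomputable section

namespace UltraAmenable

/-! ### The ultrapower `ℓ^∞(𝔛)_ω` -/

set_option linter.unusedSectionVars false

section Algebra

variable (X : Type*) [Nonempty X]

/-- The C*-algebra `ℓ^∞(𝔛)` of bounded complex functions on the set `𝔛`. -/
abbrev LInf : Type _ := lp (fun _ : X => ℂ) ∞

/-- The `ℓ^∞`-product `∏_{n ∈ ℕ} ℓ^∞(𝔛)`: uniformly bounded sequences in `ℓ^∞(𝔛)`, with
termwise operations and the supremum norm. -/
def BddSeq : Type _ := lp (fun _ : ℕ => LInf X) ∞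

instance : NormedCommRing (BddSeq X) where
  toNormedRing := lp.inftyNormedRing (B := fun _ : ℕ => LInf X)
  mul_comm _ _ := lp.ext (E := fun _ : ℕ => LInf X) (funext fun _ => mul_comm _ _)

instance : NormedAlgebra ℂ (BddSeq X) :=
  lp.inftyNormedAlgebra (𝕜 := ℂ) (B := fun _ : ℕ => LInf X)

instance : CompleteSpace (BddSeq X) :=
  lp.completeSpace (E := fun _ : ℕ => LInf X)

/-- The `n`-th term `f n ∈ ℓ^∞(𝔛)` of a bounded sequence. -/
def BddSeq.term {X : Type*} (f : BddSeq X) (n : ℕ) : LInf X :=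
  (show lp (fun _ : ℕ => LInf X) ∞ from f) n

instance : CoeFun (BddSeq X) (fun _ => ℕ → LInf X) := ⟨BddSeq.term⟩

theorem BddSeq.norm_term_le (f : BddSeq X) (n : ℕ) : ‖f n‖ ≤ ‖f‖ :=
  lp.norm_apply_le_norm (E := fun _ : ℕ => LInf X) ENNReal.top_ne_zero f n

theorem BddSeq.ext {f g : BddSeq X} (h : ∀ n, f n = g n) : f = g :=
  lp.ext (E := fun _ : ℕ => LInf X) (funext h)

/-- A uniformly bounded family `u : ℕ → ℓ^∞(𝔛)`, as an element of the product. -/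
def BddSeq.mk {X : Type*} (u : ℕ → LInf X) (C : ℝ) (hu : ∀ n, ‖u n‖ ≤ C) : BddSeq X :=
  (⟨u, memℓp_infty ⟨C, by rintro _ ⟨n, rfl⟩; exact hu n⟩⟩ : lp (fun _ : ℕ => LInf X) ∞)

theorem BddSeq.mk_term (u : ℕ → LInf X) (C : ℝ) (hu : ∀ n, ‖u n‖ ≤ C) (n : ℕ) :
    BddSeq.mk u C hu n = u n := rfl

/-- The ideal `I_ω` of bounded sequences `(f_n)` with `lim_{n → ω} ‖f_n‖ = 0`. -/
def nullIdeal (ω : Ultrafilter ℕ) : Ideal (BddSeq X) where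
  carrier := {f | Tendsto (fun n => ‖f n‖) (ω : Filter ℕ) (𝓝 0)}
  zero_mem' := by
    have h : ∀ n, (0 : BddSeq X) n = 0 := fun _ => rfl
    simp [h]
  add_mem' := by
    intro f g hf hg
    have h : Tendsto (fun n => ‖f n‖ + ‖g n‖) (ω : Filter ℕ) (𝓝 0) := by
      simpa using Tendsto.add hf hg
    exact squeeze_zero (fun n => norm_nonneg _) (fun n => norm_add_le (f n) (g n)) h
  smul_mem' := by
    intro c f hf
    have h : Tendsto (fun n => ‖c‖ * ‖f n‖) (ω : Filter ℕ) (𝓝 0) := by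
      simpa using Tendsto.const_mul ‖c‖ hf
    refine squeeze_zero (fun n => norm_nonneg _) (fun n => ?_) h
    have h1 : (c • f) n = c n * f n := rfl
    rw [h1]
    exact (norm_mul_le _ _).trans
      (mul_le_mul_of_nonneg_right (BddSeq.norm_term_le X c n) (norm_nonneg _))

theorem mem_nullIdeal {ω : Ultrafilter ℕ} {f : BddSeq X} :
    f ∈ nullIdeal X ω ↔ Tendsto (fun n => ‖f n‖) (ω : Filter ℕ) (𝓝 0) := Iff.rfl

instance nullIdeal_isClosed (ω : Ultrafilter ℕ) :
    IsClosed ((nullIdeal X ω : Ideal (BddSeq X)) : Set (BddSeq X)) := by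
  refine isClosed_of_closure_subset fun f hf => ?_
  change Tendsto (fun n => ‖f n‖) (ω : Filter ℕ) (𝓝 0)
  rw [Metric.tendsto_nhds]
  intro ε hε
  obtain ⟨g, hg, hfg⟩ := Metric.mem_closure_iff.1 hf (ε / 2) (half_pos hε)
  have hg' : Tendsto (fun n => ‖g n‖) (ω : Filter ℕ) (𝓝 0) := hg
  filter_upwards [(Metric.tendsto_nhds.1 hg') (ε / 2) (half_pos hε)] with n hn
  rw [Real.dist_eq, sub_zero, abs_of_nonneg (norm_nonneg _)] at hn ⊢
  have h1 : ‖f n - g n‖ ≤ ‖f - g‖ := BddSeq.norm_term_le X (f - g) n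
  rw [dist_eq_norm] at hfg
  have h2 : ‖f n‖ ≤ ‖f n - g n‖ + ‖g n‖ := by
    simpa using norm_add_le (f n - g n) (g n)
  linarith

theorem completeSpace_quotient {R : Type*} [NormedCommRing R] [CompleteSpace R] (I : Ideal R)
    [IsClosed (I : Set R)] : CompleteSpace (R ⧸ I) :=
  Submodule.Quotient.completeSpace I

/-- The ultrapower `ℓ^∞(𝔛)_ω = (∏_n ℓ^∞(𝔛)) / I_ω`, with its quotient norm. -/
def Ultrapower (ω : Ultrafilter ℕ) : Type _ := BddSeq X ⧸ nullIdeal X ω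

instance (ω : Ultrafilter ℕ) : NormedCommRing (Ultrapower X ω) :=
  Ideal.Quotient.normedCommRing (nullIdeal X ω)

instance (ω : Ultrafilter ℕ) : NormedAlgebra ℂ (Ultrapower X ω) :=
  Ideal.Quotient.normedAlgebra (nullIdeal X ω) (𝕜 := ℂ)

instance (ω : Ultrafilter ℕ) : CompleteSpace (Ultrapower X ω) :=
  completeSpace_quotient (nullIdeal X ω)

/-- The quotient map `(f_n) ↦ (f_n)^•` onto `ℓ^∞(𝔛)_ω`. -/
def cls (ω : Ultrafilter ℕ) : BddSeq X →ₐ[ℂ] Ultrapower X ω :=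
  Ideal.Quotient.mkₐ ℂ (nullIdeal X ω)

theorem cls_surjective (ω : Ultrafilter ℕ) : Function.Surjective (cls X ω) :=
  Ideal.Quotient.mk_surjective

theorem cls_eq_zero_iff (ω : Ultrafilter ℕ) (f : BddSeq X) :
    cls X ω f = 0 ↔ Tendsto (fun n => ‖f n‖) (ω : Filter ℕ) (𝓝 0) :=
  Ideal.Quotient.eq_zero_iff_mem

/-- The spectrum `σ(ℓ^∞(𝔛)_ω)`: the space of characters with the weak* topology. -/
abbrev Spec (ω : Ultrafilter ℕ) : Type _ := WeakDual.characterSpace ℂ (Ultrapower X ω)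

/-- The spectrum carries its Borel `σ`-algebra. -/
instance (ω : Ultrafilter ℕ) : MeasurableSpace (Spec X ω) := borel _

instance (ω : Ultrafilter ℕ) : BorelSpace (Spec X ω) := ⟨rfl⟩

end Algebra

/-! ### The action of `G` on `ℓ^∞(𝔛)_ω` and on its spectrum -/

section Action

variable (X : Type*) [Nonempty X] {G : Type*} [Group G] [MulAction G X]

/-- Translation on `ℓ^∞(𝔛)`: `(g f)(x) = f (g⁻¹ x)`. -/
def translate (g : G) : LInf X →ₐ[ℂ] LInf X where
  toFun f := ⟨fun x => f (g⁻¹ • x), by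
    refine memℓp_infty ⟨‖f‖, ?_⟩
    rintro _ ⟨x, rfl⟩
    exact lp.norm_apply_le_norm ENNReal.top_ne_zero f (g⁻¹ • x)⟩
  map_one' := rfl
  map_mul' _ _ := rfl
  map_zero' := rfl
  map_add' _ _ := rfl
  commutes' _ := rfl

theorem translate_apply (g : G) (f : LInf X) (x : X) : translate X g f x = f (g⁻¹ • x) := rfl

theorem norm_translate_le (g : G) (f : LInf X) : ‖translate X g f‖ ≤ ‖f‖ :=
  lp.norm_le_of_forall_le (norm_nonneg f)
    (fun x => lp.norm_apply_le_norm ENNReal.top_ne_zero f (g⁻¹ • x))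

/-- Termwise translation of bounded sequences. -/
def translateSeq (g : G) : BddSeq X →ₐ[ℂ] BddSeq X where
  toFun f := BddSeq.mk (fun n => translate X g (f n)) ‖f‖ fun n =>
    (norm_translate_le X g (f n)).trans (BddSeq.norm_term_le X f n)
  map_one' := rfl
  map_mul' _ _ := rfl
  map_zero' := rfl
  map_add' _ _ := rfl
  commutes' _ := rfl

theorem translateSeq_apply (g : G) (f : BddSeq X) (n : ℕ) :
    translateSeq X g f n = translate X g (f n) := rfl

theorem cls_translateSeq_eq_zero (ω : Ultrafilter ℕ) (g : G) (f : BddSeq X)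
    (hf : cls X ω f = 0) : cls X ω (translateSeq X g f) = 0 := by
  rw [cls_eq_zero_iff] at hf ⊢
  exact squeeze_zero (fun n => norm_nonneg _) (fun n => norm_translate_le X g (f n)) hf

/-- The induced translation on `ℓ^∞(𝔛)_ω`: `g (f_n)^• = (g f_n)^•`. -/
def translateUltra (ω : Ultrafilter ℕ) (g : G) : Ultrapower X ω →ₐ[ℂ] Ultrapower X ω :=
  Ideal.Quotient.liftₐ (nullIdeal X ω) ((cls X ω).comp (translateSeq X g))
    (fun f hf => cls_translateSeq_eq_zero X ω g f ((cls_eq_zero_iff X ω f).2 hf))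

theorem translateUltra_cls (ω : Ultrafilter ℕ) (g : G) (f : BddSeq X) :
    translateUltra X ω g (cls X ω f) = cls X ω (translateSeq X g f) := rfl

theorem translateUltra_one (ω : Ultrafilter ℕ) (a : Ultrapower X ω) :
    translateUltra X ω (1 : G) a = a := by
  obtain ⟨f, rfl⟩ := cls_surjective X ω a
  rw [translateUltra_cls]
  congr 1
  refine BddSeq.ext X fun n => ?_
  ext x
  simp [translateSeq_apply, translate_apply]

theorem translateUltra_mul (ω : Ultrafilter ℕ) (g h : G) (a : Ultrapower X ω) :
    translateUltra X ω (g * h) a = translateUltra X ω g (translateUltra X ω h a) := by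
  obtain ⟨f, rfl⟩ := cls_surjective X ω a
  simp only [translateUltra_cls]
  congr 1
  refine BddSeq.ext X fun n => ?_
  ext x
  simp [translateSeq_apply, translate_apply, mul_smul]

/-- The action of `G` on the spectrum which is dual to the action on `ℓ^∞(𝔛)_ω`:
`(g χ)(a) = χ(g⁻¹ a)`. -/
instance specAction (ω : Ultrafilter ℕ) : MulAction G (Spec X ω) where
  smul g χ := WeakDual.CharacterSpace.equivAlgHom.symm
    ((WeakDual.CharacterSpace.equivAlgHom χ).comp (translateUltra X ω g⁻¹))
  one_smul χ := by
    refine WeakDual.CharacterSpace.ext fun a => ?_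
    change χ (translateUltra X ω (1 : G)⁻¹ a) = χ a
    rw [inv_one, translateUltra_one]
  mul_smul g h χ := by
    refine WeakDual.CharacterSpace.ext fun a => ?_
    change χ (translateUltra X ω (g * h)⁻¹ a) =
      χ (translateUltra X ω h⁻¹ (translateUltra X ω g⁻¹ a))
    rw [mul_inv_rev, translateUltra_mul]

theorem spec_smul_apply (ω : Ultrafilter ℕ) (g : G) (χ : Spec X ω) (a : Ultrapower X ω) :
    (g • χ) a = χ (translateUltra X ω g⁻¹ a) := rfl

theorem continuous_spec_smul (ω : Ultrafilter ℕ) (g : G) :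
    Continuous (fun χ : Spec X ω => g • χ) := by
  refine Continuous.subtype_mk (WeakDual.continuous_of_continuous_eval fun a => ?_) _
  exact (WeakDual.eval_continuous (translateUltra X ω g⁻¹ a)).comp continuous_subtype_val

end Action

/-! ### Measures on the spectrum -/

section Measures

variable {X : Type*} [Nonempty X]

/-- `μ` is the measure `μ_ξ` of a sequence `ξ = (ξ_n)` in `ℓ²(𝔛)`: the Radon measure on
`σ(ℓ^∞(𝔛)_ω)` which corresponds to the functional `(f_n)^• ↦ lim_{n → ω} ⟨f_n ξ_n, ξ_n⟩`. -/
def IsVectorMeasure (ω : Ultrafilter ℕ) (ξ : ℕ → lp (fun _ : X => ℂ) 2)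
    (μ : Measure (Spec X ω)) : Prop :=
  μ.Regular ∧ ∀ f : BddSeq X,
    Tendsto (fun n => ∑' x : X, f n x * ξ n x * (starRingEnd ℂ) (ξ n x)) (ω : Filter ℕ)
      (𝓝 (∫ χ, χ (cls X ω f) ∂μ))

open Classical in
/-- The sequence `ξ_n = ∑_i α_i δ_{s_i x_n}` in `ℓ²(𝔛)` (the sum converges in norm when
`∑ α_i < ∞`). -/
def approxVector {G : Type*} [Group G] [MulAction G X] (s : ℕ → G) (α : ℕ → ℝ) (x : ℕ → X)
    (n : ℕ) : lp (fun _ : X => ℂ) 2 :=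
  ∑' i : ℕ, (α i : ℂ) • lp.single 2 (s i • x n) (1 : ℂ)

/-- `μ` is a uniform approximant of a non-standard point, associated to the coefficients `α`:
a Radon probability measure of the form `μ_ξ` with `ξ_n = ∑_i α_i δ_{s_i x_n}` for some sequence
`(x_n)` in `𝔛`, where `α_i ≥ 0` and `∑_{i,j} α_i α_j < ∞`. -/
def IsUniformApproximant {G : Type*} [Group G] [MulAction G X] (ω : Ultrafilter ℕ) (s : ℕ → G)
    (α : ℕ → ℝ) (μ : Measure (Spec X ω)) : Prop :=
  (∀ i, 0 ≤ α i) ∧ Summable (fun p : ℕ × ℕ => α p.1 * α p.2) ∧ IsProbabilityMeasure μ ∧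
    ∃ x : ℕ → X, IsVectorMeasure ω (approxVector s α x) μ

end Measures

/-! ### Quasi-invariance, `L^∞`, and amenability of pairs -/

section Pairs

open Measure

/-- Pull-back `F ↦ F ∘ T` on `L^∞` along a map that preserves null sets. -/
def pullback {Y Z : Type*} [MeasurableSpace Y] [MeasurableSpace Z] {μ : Measure Y}
    {ν : Measure Z} (T : Y → Z) (hT : QuasiMeasurePreserving T μ ν) :
    Lp ℂ ∞ ν →ₗ[ℂ] Lp ℂ ∞ μ where
  toFun F := ⟨(F : Z →ₘ[ν] ℂ).compQuasiMeasurePreserving T hT, by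
    rw [Lp.mem_Lp_iff_eLpNorm_lt_top,
      eLpNorm_congr_ae (AEEqFun.coeFn_compQuasiMeasurePreserving _ hT), eLpNorm_exponent_top]
    refine lt_of_le_of_lt ?_ (Lp.eLpNorm_lt_top F)
    rw [eLpNorm_exponent_top]
    exact essSup_le_of_ae_le _ (hT.ae ae_le_eLpNormEssSup)⟩
  map_add' F F' := by
    apply Lp.ext
    refine (AEEqFun.coeFn_compQuasiMeasurePreserving _ hT).trans ?_
    refine EventuallyEq.trans ?_ (Lp.coeFn_add _ _).symm
    filter_upwards [hT.ae (Lp.coeFn_add F F'), AEEqFun.coeFn_compQuasiMeasurePreserving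
      (F : Z →ₘ[ν] ℂ) hT, AEEqFun.coeFn_compQuasiMeasurePreserving (F' : Z →ₘ[ν] ℂ) hT]
      with y h h1 h2
    simp only [Function.comp_apply, Pi.add_apply] at h h1 h2 ⊢
    rw [h, h1, h2]
  map_smul' c F := by
    apply Lp.ext
    refine (AEEqFun.coeFn_compQuasiMeasurePreserving _ hT).trans ?_
    refine EventuallyEq.trans ?_ (Lp.coeFn_smul _ _).symm
    filter_upwards [hT.ae (Lp.coeFn_smul c F), AEEqFun.coeFn_compQuasiMeasurePreserving
      (F : Z →ₘ[ν] ℂ) hT] with y h h1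
    simp only [Function.comp_apply, Pi.smul_apply, RingHom.id_apply] at h h1 ⊢
    rw [h, h1]

theorem pullback_ae {Y Z : Type*} [MeasurableSpace Y] [MeasurableSpace Z] {μ : Measure Y}
    {ν : Measure Z} (T : Y → Z) (hT : QuasiMeasurePreserving T μ ν) (F : Lp ℂ ∞ ν) :
    pullback T hT F =ᵐ[μ] F ∘ T :=
  AEEqFun.coeFn_compQuasiMeasurePreserving _ hT

variable {G Y : Type*} [Group G] [MulAction G Y] [MeasurableSpace Y]

/-- `μ` is quasi-invariant: every `g ∈ G` acts by a measurable map and leaves the measure class of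
`μ` invariant. -/
def IsQuasiInvariant (G : Type*) {Y : Type*} [Group G] [MulAction G Y] [MeasurableSpace Y]
    (μ : Measure Y) : Prop :=
  ∀ g : G, QuasiMeasurePreserving (fun y => g • y) μ μ

/-- The action of `G` on `L^∞(μ)`: `(g F)(y) = F (g⁻¹ y)`. -/
def actLinf {μ : Measure Y} (hμ : IsQuasiInvariant G μ) (g : G) : Lp ℂ ∞ μ →ₗ[ℂ] Lp ℂ ∞ μ :=
  pullback (fun y => g⁻¹ • y) (hμ g⁻¹)

/-- The diagonal action of `G` on `L^∞(μ ⊗ μ)`: `(g F)(y, z) = F (g⁻¹ y, g⁻¹ z)`. -/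
def actLinfProd {μ : Measure Y} [SFinite μ] (hμ : IsQuasiInvariant G μ) (g : G) :
    Lp ℂ ∞ (μ.prod μ) →ₗ[ℂ] Lp ℂ ∞ (μ.prod μ) :=
  pullback (Prod.map (fun y => g⁻¹ • y) (fun y => g⁻¹ • y)) 
    (QuasiMeasurePreserving.prodMap (hμ g⁻¹) (hμ g⁻¹))

/-- The inclusion `L^∞(μ) → L^∞(μ ⊗ μ)`, `f ↦ f ⊗ 1`. -/
def inclLinf (μ : Measure Y) [SFinite μ] : Lp ℂ ∞ μ →ₗ[ℂ] Lp ℂ ∞ (μ.prod μ) :=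
  pullback Prod.fst quasiMeasurePreserving_fst

/-- The pair `(L^∞(μ ⊗ μ), L^∞(μ))` is amenable: there is a `G`-equivariant norm-one projection
`E : L^∞(μ ⊗ μ) → L^∞(μ)`, i.e. an equivariant linear contraction with `E (f ⊗ 1) = f`. -/
def IsPairAmenable (μ : Measure Y) [SFinite μ] (hμ : IsQuasiInvariant G μ) : Prop :=
  ∃ E : Lp ℂ ∞ (μ.prod μ) →L[ℂ] Lp ℂ ∞ μ,
    ‖E‖ ≤ 1 ∧ (∀ f : Lp ℂ ∞ μ, E (inclLinf μ f) = f) ∧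
      ∀ (g : G) (F : Lp ℂ ∞ (μ.prod μ)), E (actLinfProd hμ g F) = actLinf hμ g (E F)

end Pairs

end UltraAmenable

end

/-!
The measure `μ` turns out to be purely atomic, and then restriction to the diagonal,
`(E F)(y) = F (y, y)`, is the required projection: it is well defined because the diagonal map does
not charge `μ ⊗ μ`-null sets when `μ` is concentrated on a countable set
(`quasiMeasurePreserving_diag`), and it visibly commutes with the diagonal action and satisfies
`E (f ⊗ 1) = f` (`isPairAmenable_of_countable`).

Atomicity is checked on each uniform approximant `μ_ξ`, `ξ_n = ∑ α_i δ_{s_i x_n}`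
(`IsUniformApproximant.exists_countable`). The atoms are the point characters
`χ_i : (f_n)^• ↦ lim_ω f_n (s_i x_n)`. Sequences `B = (B_n)` of subsets of `𝔛` give idempotents of
the ultrapower, hence clopen subsets of the spectrum, and these form neighbourhood bases at point
characters (`exists_clopenOf_subset`). So if `K` is a compact set that contains no `χ_i`, then for
each `N` some `B` contains `s_i x_n` for `i < N` and `ω`-almost all `n`, while its clopen set is
disjoint from `K`. Therefore `μ_ξ K` is at most the limit of the masses that `|ξ_n|²` gives to the
complements of the `B_n`. Only the tail `∑_{i ≥ N} α_i δ_{s_i x_n}` contributes there, whence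
`μ_ξ K ≤ (∑_{i ≥ N} α_i)²` (`tsum_indicator_approxVector_le`). Letting `N → ∞` gives `μ_ξ K = 0`,
and inner regularity shows that the complement of `{χ_i}` is null.
-/

namespace UltraAmenable

/-! ### Restriction to the diagonal for purely atomic measures -/

section Diagonal

variable {Y Z W : Type*} [MeasurableSpace Y] [MeasurableSpace Z] [MeasurableSpace W]

theorem norm_pullback_le {μ : Measure Y} {ν : Measure Z} (T : Y → Z)
    (hT : Measure.QuasiMeasurePreserving T μ ν) (F : Lp ℂ ∞ ν) : ‖pullback T hT F‖ ≤ ‖F‖ := by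
  rw [Lp.norm_def, Lp.norm_def]
  refine ENNReal.toReal_mono (Lp.eLpNorm_ne_top F) ?_
  rw [eLpNorm_congr_ae (pullback_ae T hT F), eLpNorm_exponent_top, eLpNorm_exponent_top]
  exact essSup_le_of_ae_le _ (hT.ae ae_le_eLpNormEssSup)

theorem pullback_pullback_ae {μ : Measure Y} {ν : Measure Z} {ρ : Measure W} (S : Y → Z)
    (hS : Measure.QuasiMeasurePreserving S μ ν) (T : Z → W)
    (hT : Measure.QuasiMeasurePreserving T ν ρ) (F : Lp ℂ ∞ ρ) :
    pullback S hS (pullback T hT F) =ᵐ[μ] F ∘ T ∘ S :=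
  (pullback_ae S hS _).trans (hS.ae (pullback_ae T hT F))

/-- If `μ` is concentrated on a countable set, the diagonal map does not charge
`μ ⊗ μ`-null sets: an atom `y` with `(y, y)` in a null set satisfies `μ {y} * μ {y} = 0`. -/
theorem quasiMeasurePreserving_diag [MeasurableSingletonClass Y] (μ : Measure Y) [SFinite μ]
    {S : Set Y} (hS : S.Countable) (hμS : μ Sᶜ = 0) :
    Measure.QuasiMeasurePreserving (fun y : Y => (y, y)) μ (μ.prod μ) := by
  have hm : Measurable (fun y : Y => (y, y)) := measurable_id.prodMk measurable_id
  refine ⟨hm, Measure.AbsolutelyContinuous.mk fun N hN h0 => ?_⟩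
  rw [Measure.map_apply hm hN]
  refine measure_mono_null (t := Sᶜ ∪ ⋃ y ∈ S ∩ {y | (y, y) ∈ N}, {y}) ?_ ?_
  · intro y hy
    by_cases h : y ∈ S
    · exact Or.inr (Set.mem_biUnion (⟨h, hy⟩ : y ∈ S ∩ {y | (y, y) ∈ N}) rfl)
    · exact Or.inl h
  · refine measure_union_null hμS ((measure_biUnion_null_iff (hS.mono Set.inter_subset_left)).2 ?_)
    rintro y ⟨-, hy⟩
    have h : μ.prod μ ({y} ×ˢ {y}) = 0 := by
      refine measure_mono_null ?_ h0
      rw [Set.singleton_prod_singleton, Set.singleton_subset_iff]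
      exact hy
    rw [Measure.prod_prod] at h
    exact mul_self_eq_zero.1 h

/-- For a measure that is concentrated on a countable set, restriction to the diagonal,
`(E F)(y) = F (y, y)`, is an equivariant norm-one projection. -/
theorem isPairAmenable_of_countable {G : Type*} [Group G] [MulAction G Y]
    [MeasurableSingletonClass Y] (μ : Measure Y) [SFinite μ] (hμ : IsQuasiInvariant G μ)
    {S : Set Y} (hS : S.Countable) (hμS : μ Sᶜ = 0) : IsPairAmenable μ hμ := by
  have hd := quasiMeasurePreserving_diag μ hS hμS
  refine ⟨(pullback _ hd).mkContinuous 1 fun F => ?_, ?_, fun f => ?_, fun g F => ?_⟩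
  · rw [one_mul]
    exact norm_pullback_le _ hd F
  · exact LinearMap.mkContinuous_norm_le _ zero_le_one _
  · exact Lp.ext (pullback_pullback_ae _ hd Prod.fst Measure.quasiMeasurePreserving_fst f)
  · exact Lp.ext ((pullback_pullback_ae _ hd _ _ F).trans
      (pullback_pullback_ae _ (hμ g⁻¹) _ hd F).symm)

end Diagonal

/-! ### Point characters and internal idempotents of the ultrapower -/

section Points

variable {X : Type*}

/-- The internal idempotent `(1_{B_n})_n` of a sequence `B` of subsets of `𝔛`. -/
noncomputable def indSeq (B : ℕ → Set X) : BddSeq X :=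
  BddSeq.mk (fun n => ⟨(B n).indicator 1, memℓp_infty ⟨1, by
    rintro _ ⟨x, rfl⟩
    by_cases h : x ∈ B n <;> simp [h]⟩⟩) 1 fun n =>
      lp.norm_le_of_forall_le zero_le_one fun x => by
        by_cases h : x ∈ B n <;> simp [h]

theorem indSeq_apply (B : ℕ → Set X) (n : ℕ) (x : X) :
    indSeq B n x = (B n).indicator 1 x := rfl

variable [Nonempty X]

theorem BddSeq.ext_apply {f g : BddSeq X} (h : ∀ n x, f n x = g n x) : f = g :=
  BddSeq.ext X fun n => lp.ext (funext (h n))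

theorem BddSeq.mul_apply (f g : BddSeq X) (n : ℕ) (x : X) : (f * g) n x = f n x * g n x := rfl

theorem BddSeq.sub_apply (f g : BddSeq X) (n : ℕ) (x : X) : (f - g) n x = f n x - g n x := rfl

theorem BddSeq.algebraMap_apply (c : ℂ) (n : ℕ) (x : X) :
    (algebraMap ℂ (BddSeq X) c) n x = c := rfl

theorem BddSeq.norm_apply_le (f : BddSeq X) (n : ℕ) (x : X) : ‖f n x‖ ≤ ‖f‖ :=
  (lp.norm_apply_le_norm ENNReal.top_ne_zero (f n) x).trans (BddSeq.norm_term_le X f n)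

theorem BddSeq.norm_le {f : BddSeq X} {C : ℝ} (hC : 0 ≤ C) (h : ∀ n x, ‖f n x‖ ≤ C) :
    ‖f‖ ≤ C :=
  lp.norm_le_of_forall_le (E := fun _ : ℕ => LInf X) hC fun n =>
    lp.norm_le_of_forall_le hC (h n)

theorem indSeq_inter (B C : ℕ → Set X) : indSeq (fun n => B n ∩ C n) = indSeq B * indSeq C :=
  BddSeq.ext_apply fun n x => by
    rw [BddSeq.mul_apply, indSeq_apply, indSeq_apply, indSeq_apply, Set.inter_indicator_one,
      Pi.mul_apply]

theorem indSeq_compl (B : ℕ → Set X) : indSeq (fun n => (B n)ᶜ) = 1 - indSeq B :=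
  BddSeq.ext_apply fun n x => by
    change (B n)ᶜ.indicator (1 : X → ℂ) x = 1 - (B n).indicator (1 : X → ℂ) x
    by_cases h : x ∈ B n <;> simp [h]

theorem indSeq_univ : indSeq (fun _ => (Set.univ : Set X)) = 1 :=
  BddSeq.ext_apply fun n x => by
    change Set.univ.indicator (1 : X → ℂ) x = 1
    simp

theorem spec_apply_algebraMap (ω : Ultrafilter ℕ) (χ : Spec X ω) (c : ℂ) :
    χ (algebraMap ℂ (Ultrapower X ω) c) = c :=
  (WeakDual.CharacterSpace.equivAlgHom χ).commutes c

theorem spec_apply_one (ω : Ultrafilter ℕ) (χ : Spec X ω) : χ 1 = 1 :=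
  (WeakDual.CharacterSpace.equivAlgHom χ).map_one

theorem norm_apply_cls_le (ω : Ultrafilter ℕ) (χ : Spec X ω) (f : BddSeq X) :
    ‖χ (cls X ω f)‖ ≤ ‖f‖ := by
  have h := AlgHom.norm_apply_le_self_mul_norm_one
    ((WeakDual.CharacterSpace.equivAlgHom χ).comp (cls X ω)) f
  have h1 : ‖(1 : BddSeq X)‖ ≤ 1 := BddSeq.norm_le zero_le_one fun n x => by
    change ‖(1 : ℂ)‖ ≤ 1
    simp
  exact h.trans (mul_le_of_le_one_right (norm_nonneg f) h1)

/-- The limit along `ω` of the values of `f` along a sequence of points exists. -/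
theorem exists_tendsto_eval (ω : Ultrafilter ℕ) (y : ℕ → X) (f : BddSeq X) :
    ∃ z : ℂ, Tendsto (fun n => f n (y n)) (ω : Filter ℕ) (𝓝 z) := by
  obtain ⟨z, -, hz⟩ := (isCompact_closedBall (0 : ℂ) ‖f‖).ultrafilter_le_nhds
    (ω.map fun n => f n (y n)) (by
      rw [le_principal_iff]
      exact mem_map.2 (univ_mem' fun n => by simpa using BddSeq.norm_apply_le f n (y n)))
  exact ⟨z, hz⟩

/-- Evaluation of bounded sequences at the internal point `(y_n)`: `(f_n) ↦ lim_ω f_n(y_n)`. -/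
noncomputable def evalSeq (ω : Ultrafilter ℕ) (y : ℕ → X) : BddSeq X →ₐ[ℂ] ℂ where
  toFun f := (exists_tendsto_eval ω y f).choose
  map_one' := tendsto_nhds_unique (exists_tendsto_eval ω y 1).choose_spec tendsto_const_nhds
  map_mul' f g := tendsto_nhds_unique (exists_tendsto_eval ω y (f * g)).choose_spec
    ((exists_tendsto_eval ω y f).choose_spec.mul (exists_tendsto_eval ω y g).choose_spec)
  map_zero' := tendsto_nhds_unique (exists_tendsto_eval ω y 0).choose_spec tendsto_const_nhds
  map_add' f g := tendsto_nhds_unique (exists_tendsto_eval ω y (f + g)).choose_spec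
    ((exists_tendsto_eval ω y f).choose_spec.add (exists_tendsto_eval ω y g).choose_spec)
  commutes' _ := tendsto_nhds_unique (exists_tendsto_eval ω y _).choose_spec tendsto_const_nhds

theorem tendsto_evalSeq (ω : Ultrafilter ℕ) (y : ℕ → X) (f : BddSeq X) :
    Tendsto (fun n => f n (y n)) (ω : Filter ℕ) (𝓝 (evalSeq ω y f)) :=
  (exists_tendsto_eval ω y f).choose_spec

/-- The character `(f_n)^• ↦ lim_ω f_n(y_n)` of the ultrapower given by the internal point
`(y_n)`. -/
noncomputable def pointChar (ω : Ultrafilter ℕ) (y : ℕ → X) : Spec X ω :=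
  WeakDual.CharacterSpace.equivAlgHom.symm
    (Ideal.Quotient.liftₐ (nullIdeal X ω) (evalSeq ω y) fun f hf =>
      tendsto_nhds_unique (tendsto_evalSeq ω y f) (squeeze_zero_norm
        (fun n => lp.norm_apply_le_norm ENNReal.top_ne_zero (f n) (y n)) hf))

theorem tendsto_pointChar (ω : Ultrafilter ℕ) (y : ℕ → X) (f : BddSeq X) :
    Tendsto (fun n => f n (y n)) (ω : Filter ℕ) (𝓝 (pointChar ω y (cls X ω f))) :=
  tendsto_evalSeq ω y f

/-- The clopen subset of the spectrum given by the internal set `(B_n)`. -/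
def clopenOf (ω : Ultrafilter ℕ) (B : ℕ → Set X) : Set (Spec X ω) :=
  {χ | χ (cls X ω (indSeq B)) = 1}

theorem apply_indSeq_eq_zero_or_one (ω : Ultrafilter ℕ) (B : ℕ → Set X) (χ : Spec X ω) :
    χ (cls X ω (indSeq B)) = 0 ∨ χ (cls X ω (indSeq B)) = 1 := by
  have h : χ (cls X ω (indSeq B)) * χ (cls X ω (indSeq B)) = χ (cls X ω (indSeq B)) := by
    rw [← map_mul, ← map_mul, ← indSeq_inter]
    simp only [Set.inter_self]
  have h2 : χ (cls X ω (indSeq B)) * (χ (cls X ω (indSeq B)) - 1) = 0 := by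
    rw [mul_sub, h, mul_one, sub_self]
  exact (mul_eq_zero.1 h2).imp_right sub_eq_zero.1

theorem clopenOf_compl (ω : Ultrafilter ℕ) (B : ℕ → Set X) :
    clopenOf ω (fun n => (B n)ᶜ) = (clopenOf ω B)ᶜ := by
  ext χ
  change χ (cls X ω (indSeq fun n => (B n)ᶜ)) = 1 ↔ ¬ χ (cls X ω (indSeq B)) = 1
  rw [indSeq_compl, map_sub, map_one, map_sub, spec_apply_one]
  rcases apply_indSeq_eq_zero_or_one ω B χ with h | h <;> simp [h]

theorem clopenOf_inter (ω : Ultrafilter ℕ) (B C : ℕ → Set X) :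
    clopenOf ω (fun n => B n ∩ C n) = clopenOf ω B ∩ clopenOf ω C := by
  ext χ
  change χ (cls X ω (indSeq fun n => B n ∩ C n)) = 1 ↔
    χ (cls X ω (indSeq B)) = 1 ∧ χ (cls X ω (indSeq C)) = 1
  rw [indSeq_inter, map_mul, map_mul]
  rcases apply_indSeq_eq_zero_or_one ω B χ with h | h <;> simp [h]

theorem clopenOf_union (ω : Ultrafilter ℕ) (B C : ℕ → Set X) :
    clopenOf ω (fun n => B n ∪ C n) = clopenOf ω B ∪ clopenOf ω C := by
  have h := clopenOf_compl ω fun n => (B n)ᶜ ∩ (C n)ᶜ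
  simpa [Set.compl_inter, clopenOf_inter, clopenOf_compl] using h

theorem clopenOf_univ (ω : Ultrafilter ℕ) :
    clopenOf ω (fun _ => (Set.univ : Set X)) = Set.univ := by
  refine Set.eq_univ_of_forall fun χ => ?_
  change χ (cls X ω (indSeq fun _ => Set.univ)) = 1
  rw [indSeq_univ, map_one, spec_apply_one]

theorem clopenOf_empty (ω : Ultrafilter ℕ) :
    clopenOf ω (fun _ => (∅ : Set X)) = ∅ := by
  have h := clopenOf_compl ω fun _ => (Set.univ : Set X)
  simpa [clopenOf_univ] using h

theorem isClosed_clopenOf (ω : Ultrafilter ℕ) (B : ℕ → Set X) : IsClosed (clopenOf ω B) :=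
  isClosed_eq ((WeakDual.eval_continuous _).comp continuous_subtype_val) continuous_const

/-- Internal sets give a basis of neighbourhoods of a point character: on the clopen set of
`{x : |f_n(x) - c| ≤ ε}` every character takes `(f_n)^•` to a value within `ε` of `c`. -/
theorem exists_clopenOf_subset (ω : Ultrafilter ℕ) (y : ℕ → X) {U : Set (Spec X ω)}
    (hU : U ∈ 𝓝 (pointChar ω y)) :
    ∃ B : ℕ → Set X, (∀ᶠ n in (ω : Filter ℕ), y n ∈ B n) ∧ clopenOf ω B ⊆ U := by
  let S : Set (ℕ → Set X) := {B | ∀ᶠ n in (ω : Filter ℕ), y n ∈ B n}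
  let F : Filter (Spec X ω) := ⨅ B ∈ S, 𝓟 (clopenOf ω B)
  have hF : F.HasBasis (fun B => B ∈ S) (clopenOf ω) := by
    refine hasBasis_biInf_principal (fun B hB C hC => ?_)
      ⟨fun _ => Set.univ, Eventually.of_forall fun n => Set.mem_univ _⟩
    refine ⟨fun n => B n ∩ C n, ?_, ?_, ?_⟩
    · exact Eventually.and (f := (ω : Filter ℕ)) hB hC
    · simp [clopenOf_inter, Order.Preimage]
    · simp [clopenOf_inter, Order.Preimage]
  have hle : Tendsto id F (𝓝 (pointChar ω y)) := by
    rw [tendsto_subtype_rng, tendsto_iff_forall_eval_tendsto_topDualPairing]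
    intro a
    obtain ⟨f, rfl⟩ := cls_surjective X ω a
    change Tendsto (fun χ : Spec X ω => χ (cls X ω f)) F (𝓝 (pointChar ω y (cls X ω f)))
    set c := pointChar ω y (cls X ω f)
    rw [Metric.tendsto_nhds]
    intro ε hε
    let B : ℕ → Set X := fun n => {x | ‖f n x - c‖ ≤ ε / 2}
    have hB : B ∈ S := by
      filter_upwards [(Metric.tendsto_nhds.1 (tendsto_pointChar ω y f)) (ε / 2) (half_pos hε)]
        with n hn
      rw [dist_eq_norm] at hn
      exact hn.le
    filter_upwards [hF.mem_of_mem hB] with χ hχ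
    have hχ1 : χ (cls X ω (indSeq B)) = 1 := hχ
    have h1 : ‖χ (cls X ω ((f - algebraMap ℂ _ c) * indSeq B))‖ ≤ ε / 2 := by
      refine (norm_apply_cls_le ω χ _).trans (BddSeq.norm_le (half_pos hε).le fun n x => ?_)
      rw [BddSeq.mul_apply, BddSeq.sub_apply, BddSeq.algebraMap_apply, indSeq_apply]
      by_cases h : x ∈ B n
      · simpa [h] using (show ‖f n x - c‖ ≤ ε / 2 from h)
      · simpa [h] using (half_pos hε).le
    rw [map_mul, map_mul, hχ1, mul_one, map_sub, map_sub, AlgHom.commutes, spec_apply_algebraMap]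
      at h1
    rw [dist_eq_norm]
    exact lt_of_le_of_lt h1 (half_lt_self hε)
  obtain ⟨B, hB, hBU⟩ := hF.mem_iff.1 (hle hU)
  exact ⟨B, hB, hBU⟩

/-- An open set containing finitely many point characters contains a clopen set, coming from an
internal set that contains all the corresponding internal points. -/
theorem exists_clopenOf_subset_finset (ω : Ultrafilter ℕ) {ι : Type*} (y : ι → ℕ → X)
    {U : Set (Spec X ω)} (hU : IsOpen U) (T : Finset ι) (hT : ∀ i ∈ T, pointChar ω (y i) ∈ U) :
    ∃ B : ℕ → Set X, (∀ᶠ n in (ω : Filter ℕ), ∀ i ∈ T, y i n ∈ B n) ∧ clopenOf ω B ⊆ U := by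
  classical
  choose! B hB hBU using fun i hi => exists_clopenOf_subset ω (y i) (hU.mem_nhds (hT i hi))
  induction T using Finset.induction_on with
  | empty => exact ⟨fun _ => ∅, by simp, by simp [clopenOf_empty]⟩
  | insert i T hi ih =>
    simp only [Finset.mem_insert, forall_eq_or_imp] at hT hB hBU
    obtain ⟨C, hC, hCU⟩ := ih hT.2 hB.2 hBU.2
    refine ⟨fun n => B i n ∪ C n, ?_, ?_⟩
    · filter_upwards [hB.1, hC] with n h1 h2
      simp only [Finset.mem_insert, forall_eq_or_imp]
      exact ⟨Or.inl h1, fun j hj => Or.inr (h2 j hj)⟩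
    · rw [clopenOf_union]
      exact Set.union_subset hBU.1 hCU

end Points

/-! ### Uniform approximants are purely atomic -/

section Atomic

variable {X : Type*}

/-- The integral of an internal idempotent is the measure of its clopen set, so that `μ_ξ` of the
clopen set is the limit of the masses that `|ξ_n|²` gives to the sets `B_n`. -/
theorem IsVectorMeasure.tendsto_real_clopenOf [Nonempty X] {ω : Ultrafilter ℕ} {ξ : ℕ → lp (fun _ : X => ℂ) 2}
    {μ : Measure (Spec X ω)} (h : IsVectorMeasure ω ξ μ) (B : ℕ → Set X) :
    Tendsto (fun n => ∑' x, (B n).indicator (fun x => ‖ξ n x‖ ^ 2) x) (ω : Filter ℕ)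
      (𝓝 (μ.real (clopenOf ω B))) := by
  have h1 : ∫ χ : Spec X ω, χ (cls X ω (indSeq B)) ∂μ = (μ.real (clopenOf ω B) : ℂ) := by
    have h2 : (fun χ : Spec X ω => χ (cls X ω (indSeq B))) = (clopenOf ω B).indicator 1 := by
      funext χ
      by_cases hχ : χ ∈ clopenOf ω B
      · rw [Set.indicator_of_mem hχ]
        exact hχ
      · rw [Set.indicator_of_notMem hχ]
        exact (apply_indSeq_eq_zero_or_one ω B χ).resolve_right hχ
    rw [h2, Pi.one_def, integral_indicator_const _ (isClosed_clopenOf ω B).measurableSet]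
    simp
  have h3 := h.2 (indSeq B)
  rw [h1] at h3
  have h4 := (Complex.continuous_re.tendsto _).comp h3
  rw [Complex.ofReal_re] at h4
  refine h4.congr fun n => ?_
  have h5 : ∀ x, indSeq B n x * ξ n x * (starRingEnd ℂ) (ξ n x) =
      (((B n).indicator (fun x => ‖ξ n x‖ ^ 2) x : ℝ) : ℂ) := by
    intro x
    rw [indSeq_apply, mul_assoc, Complex.mul_conj']
    by_cases hx : x ∈ B n <;> simp [hx]
  simp only [Function.comp_apply, h5]
  rw [← Complex.ofReal_tsum, Complex.ofReal_re]

variable {G : Type*} [Group G] [MulAction G X]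

/-- The mass of `|ξ_n|²` on a set that misses `s_i x_n` for `i < N` is at most
`(∑_{i ≥ N} α_i)²`, as `ξ_n` agrees there with the tail of its series. -/
theorem tsum_indicator_approxVector_le (s : ℕ → G) {α : ℕ → ℝ} (hα : ∀ i, 0 ≤ α i)
    (hsum : Summable α) (x : ℕ → X) (n N : ℕ) {B : Set X} (hB : ∀ i < N, s i • x n ∉ B) :
    ∑' z, B.indicator (fun z => ‖approxVector s α x n z‖ ^ 2) z ≤ (∑' i, α (i + N)) ^ 2 := by
  classical
  let v : ℕ → lp (fun _ : X => ℂ) 2 := fun i => (α i : ℂ) • lp.single 2 (s i • x n) (1 : ℂ)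
  have hv : ∀ i, ‖v i‖ = α i := fun i => by
    simp only [v]
    rw [norm_smul, lp.norm_single (by norm_num)]
    simp [abs_of_nonneg (hα i)]
  have hvs : Summable v := Summable.of_norm (by simpa only [hv] using hsum)
  let η : lp (fun _ : X => ℂ) 2 := ∑' i, v (i + N)
  have hη : ‖η‖ ≤ ∑' i, α (i + N) := by
    refine (norm_tsum_le_tsum_norm ?_).trans_eq (tsum_congr fun i => hv _)
    simpa only [hv] using (summable_nat_add_iff N).2 hsum
  have hξ : approxVector s α x n = ∑ i ∈ Finset.range N, v i + η := by
    rw [hvs.sum_add_tsum_nat_add N]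
    simp only [approxVector, v]
  have hz : ∀ z ∈ B, approxVector s α x n z = η z := fun z hzB => by
    have h0 : (∑ i ∈ Finset.range N, v i : lp (fun _ : X => ℂ) 2) z = 0 := by
      rw [lp.coeFn_sum, Finset.sum_apply]
      refine Finset.sum_eq_zero fun i hi => ?_
      have hne : z ≠ s i • x n := fun h => hB i (Finset.mem_range.1 hi) (h ▸ hzB)
      change (α i : ℂ) • lp.single (E := fun _ : X => ℂ) 2 (s i • x n) (1 : ℂ) z = 0
      rw [lp.single_apply_ne _ _ _ hne, smul_zero]
    rw [hξ, lp.coeFn_add, Pi.add_apply, h0, zero_add]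
  have hsq : HasSum (fun z => ‖η z‖ ^ 2) (‖η‖ ^ 2) := by
    simpa using lp.hasSum_norm (p := 2) (by norm_num) η
  calc ∑' z, B.indicator (fun z => ‖approxVector s α x n z‖ ^ 2) z
      = ∑' z, B.indicator (fun z => ‖η z‖ ^ 2) z := tsum_congr fun z => by
        by_cases h : z ∈ B <;> simp [h, hz]
    _ ≤ ∑' z, ‖η z‖ ^ 2 := (hsq.summable.indicator B).tsum_le_tsum
        (fun z => Set.indicator_le_self' (fun _ _ => sq_nonneg _) z) hsq.summable
    _ = ‖η‖ ^ 2 := hsq.tsum_eq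
    _ ≤ _ := pow_le_pow_left₀ (norm_nonneg _) hη 2

/-- A uniform approximant is concentrated on the countable orbit of the point character it
approximates. -/
theorem IsUniformApproximant.exists_countable [Nonempty X] {ω : Ultrafilter ℕ} {s : ℕ → G} {α : ℕ → ℝ}
    (hα0 : ∀ i, 0 < α i) {μ : Measure (Spec X ω)} (h : IsUniformApproximant ω s α μ) :
    ∃ S : Set (Spec X ω), S.Countable ∧ μ Sᶜ = 0 := by
  obtain ⟨hα, hsum2, hp, x, hx⟩ := h
  have := hx.1
  have hsum : Summable α := by
    have h1 := hsum2.comp_injective (i := fun i : ℕ => ((0 : ℕ), i))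
      fun a b hab => (Prod.ext_iff.1 hab).2
    exact (summable_mul_left_iff (hα0 0).ne').1 h1
  let y : ℕ → ℕ → X := fun i n => s i • x n
  let S : Set (Spec X ω) := Set.range fun i => pointChar ω (y i)
  have hS : S.Countable := Set.countable_range _
  refine ⟨S, hS, ?_⟩
  -- By inner regularity it is enough to treat compact sets that miss all the points.
  rw [hS.measurableSet.compl.measure_eq_iSup_isCompact_of_ne_top (measure_ne_top μ _)]
  simp only [ENNReal.iSup_eq_zero]
  intro K hKS hK
  have hbound : ∀ N, μ.real K ≤ (∑' i, α (i + N)) ^ 2 := by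
    intro N
    obtain ⟨B, hB, hBK⟩ := exists_clopenOf_subset_finset ω y hK.isClosed.isOpen_compl
      (Finset.range N) fun i _ hi => hKS hi ⟨i, rfl⟩
    have hsub : K ⊆ clopenOf ω fun n => (B n)ᶜ := by
      rw [clopenOf_compl]
      exact Set.subset_compl_comm.1 hBK
    refine (measureReal_mono hsub).trans (le_of_tendsto (hx.tendsto_real_clopenOf _) ?_)
    filter_upwards [hB] with n hn
    exact tsum_indicator_approxVector_le s hα hsum x n N
      fun i hi hi' => hi' (hn i (Finset.mem_range.2 hi))
  have hlim : Tendsto (fun N => (∑' i, α (i + N)) ^ 2) atTop (𝓝 0) := by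
    simpa using (tendsto_sum_nat_add α).pow 2
  have h0 : μ.real K ≤ 0 := ge_of_tendsto' hlim hbound
  exact (measureReal_eq_zero_iff).1 (le_antisymm h0 measureReal_nonneg)

end Atomic

end UltraAmenable

theorem mainTheorem8 {X G : Type*} [Nonempty X] [Countable X] [Group G] [Countable G]
    [MulAction G X] (s : ℕ → G) (hs : Function.Surjective s) (hs0 : s 0 = 1)
    (ω : Ultrafilter ℕ) (hω : (ω : Filter ℕ) ≤ Filter.cofinite)
    (μ : MeasureTheory.Measure (UltraAmenable.Spec X ω))
    [MeasureTheory.IsProbabilityMeasure μ] [μ.Regular]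
    (hμ : UltraAmenable.IsQuasiInvariant G μ)
    (l : ℕ) (c : Fin l → NNReal) (hc : ∑ m, c m = 1)
    (α : Fin l → ℕ → ℝ) (hα : ∀ m i, 0 < α m i)
    (ν : Fin l → MeasureTheory.Measure (UltraAmenable.Spec X ω))
    (hν : ∀ m, UltraAmenable.IsUniformApproximant ω s (α m) (ν m))
    (hμν : μ = ∑ m, c m • ν m) :
    UltraAmenable.IsPairAmenable μ hμ := by
  choose S hS hνS using fun m => (hν m).exists_countable (hα m)
  refine UltraAmenable.isPairAmenable_of_countable μ hμ (S := ⋃ m, S m)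
    (Set.countable_iUnion hS) ?_
  rw [hμν, Measure.finsetSum_apply]
  refine Finset.sum_eq_zero fun m _ => ?_
  rw [Measure.smul_apply, measure_mono_null (Set.compl_subset_compl.2 (Set.subset_iUnion S m))
    (hνS m), smul_zero]
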